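/- Let $k$ be an algebraically closed field, let $S=k[[\alpha_1,\dots,\alpha_n]]$ with maximal ideal $\mathfrak m$, and let $P\subset \operatorname{Hom}_k(S,k)$ be the space of functionals vanishing on some power of $\mathfrak m$. It has as a basis the divided power monomials $x^{[a]}$ ($a\in\mathbb N_0^n$), dual to the monomials $\alpha^a$; the degree of $x^{[a]}$ is $\sum a_i$, and $\deg 0<0$. Write $\langle\sigma,f\rangle=f(\sigma)$, and let $S$ act on $P$ by contraction, $\langle\tau,\sigma\lrcorner f\rangle=\langle\tau\sigma,f\rangle$. Put $\operatorname{Ann}(f)=\{\sigma\in S:\sigma\lrcorner f=0\}$ and $\operatorname{Apolar}(f)=S/\operatorname{Ann}(f)$. Let $\mathbb G^+=\operatorname{Aut}^+(S)\ltimes(1+\mathfrak m)$ be the group of $k$-linear automorphisms of $S$ generated by the $k$-algebra automorphisms $\varphi$ with $\varphi(\alpha_i)-\alpha_i\in\mathfrak m^2$ for all $i$ and by the multiplications by elements of $1+\mathfrak m$. Let $\mathfrak g^+=\mathfrak{aut}^++\mathfrak m\subset\operatorname{End}_k(S)$, where $\mathfrak{aut}^+$ is the space of $k$-derivations $D$ of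 $S$ with $D(\mathfrak m)\subseteq\mathfrak m^2$ and $\mathfrak m$ acts by multiplication. Both act on $P$ through the dual maps, $\langle\sigma,L^\vee f\rangle=\langle L\sigma,f\rangle$; denote by $\mathbb G^+\!\cdot f$ the orbit of $f$ and put $\mathfrak g^+f=\{L^\vee f: L\in\mathfrak g^+\}$. For a subspace $W\subseteq P$ let $W^\perp=\{\sigma\in S:\langle\sigma,w\rangle=0\ \text{for all } w\in W\}$. For a subspace $V\subseteq S$ let $V_i$ be the set of its homogeneous elements of degree $i$. Let $f\in P$ be non-zero of degree $d$, with leading form (homogeneous part of degree $d$) $F$. Assume that the characteristic of $k$ is $0$ or greater than $d$. Let $I=\operatorname{Ann}(F)$, and let $t\ge 0$ be an integer such that 1. $\dim_k\operatorname{Apolar}(f)=\dim_k\operatorname{Apolar}(F)$, and 2. $\big((\mathfrak g^+F)^\perp\big)_i=(I^2)_i$ for all $i$ with $t\le i\le d-1$. Then there is $g\in P$ with $\deg g<t$ such that $F+g\in\mathbb G^+\!\cdot f$; moreover $\operatorname{Apolar}(f)\cong\operatorname{Apolar}(F+g)$ as $k$-algebras for this $g$. -/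

import Mathlib

namespace Macaulay

noncomputable section

variable (k : Type*) [Field k] (n : ℕ)

/-- The power series ring `S = k[[α₁, …, αₙ]]`. -/
abbrev S : Type _ := MvPowerSeries (Fin n) k

/-- The maximal ideal `𝔪` of `S`. -/
abbrev maxIdeal : Ideal (S k n) := IsLocalRing.maximalIdeal (S k n)

/-- The dual space `P ⊆ S^∨ = Hom_k(S, k)` (the divided power polynomials): the functionals
that vanish on some power of the maximal ideal. The pairing `⟨σ, f⟩` is the evaluation `f σ`. -/
def P : Submodule k (Module.Dual k (S k n)) where
  carrier := {f | ∃ D : ℕ, ∀ σ ∈ maxIdeal k n ^ D, f σ = 0}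
  zero_mem' := ⟨0, fun _ _ => rfl⟩
  add_mem' := by
    rintro f g ⟨D, hD⟩ ⟨E, hE⟩
    refine ⟨max D E, fun σ hσ => ?_⟩
    rw [LinearMap.add_apply, hD σ (Ideal.pow_le_pow_right (le_max_left _ _) hσ),
      hE σ (Ideal.pow_le_pow_right (le_max_right _ _) hσ), add_zero]
  smul_mem' := by
    rintro c f ⟨D, hD⟩
    exact ⟨D, fun σ hσ => by rw [LinearMap.smul_apply, hD σ hσ, smul_zero]⟩

variable {k n}

/-- Contraction `σ ⌟ f`, given by `⟨τ, σ ⌟ f⟩ = ⟨τ σ, f⟩`. -/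
def contract (σ : S k n) (f : P k n) : P k n :=
  ⟨f.1 ∘ₗ LinearMap.mulRight k σ, by
    obtain ⟨D, hD⟩ := f.2
    exact ⟨D, fun τ hτ => hD _ (Ideal.mul_mem_right _ _ hτ)⟩⟩

theorem contract_apply (σ τ : S k n) (f : P k n) : (contract σ f).1 τ = f.1 (τ * σ) := rfl

/-- The apolar ideal `Ann(f) = {σ ∈ S | σ ⌟ f = 0}`. -/
def apolarIdeal (f : P k n) : Ideal (S k n) where
  carrier := {σ | contract σ f = 0}
  zero_mem' := Subtype.ext <| LinearMap.ext fun τ => by simp [contract_apply]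
  add_mem' := by
    intro σ ρ hσ hρ
    refine Subtype.ext <| LinearMap.ext fun τ => ?_
    have h₁ : f.1 (τ * σ) = 0 := by rw [← contract_apply, hσ]; rfl
    have h₂ : f.1 (τ * ρ) = 0 := by rw [← contract_apply, hρ]; rfl
    simp [contract_apply, mul_add, h₁, h₂]
  smul_mem' := by
    intro c σ hσ
    refine Subtype.ext <| LinearMap.ext fun τ => ?_
    have h₁ : f.1 (τ * c * σ) = 0 := by rw [← contract_apply, hσ]; rfl
    simpa [contract_apply, mul_assoc] using h₁

/-- The apolar algebra `Apolar(f) = S / Ann(f)`. -/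
abbrev Apolar (f : P k n) : Type _ := S k n ⧸ apolarIdeal f

theorem le_order_of_mem_pow {D : ℕ} {σ : S k n} (hσ : σ ∈ maxIdeal k n ^ D) :
    (D : ℕ∞) ≤ σ.order := by
  induction D generalizing σ with
  | zero => simp
  | succ D ih =>
    rw [pow_succ] at hσ
    refine Submodule.mul_induction_on hσ (fun a ha b hb => ?_) (fun a b ha hb => ?_)
    · have hb' : (1 : ℕ∞) ≤ b.order := by
        rw [MvPowerSeries.one_le_order_iff_constCoeff_eq_zero]
        by_contra h
        rw [IsLocalRing.mem_maximalIdeal, mem_nonunits_iff, MvPowerSeries.isUnit_iff_constantCoeff,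
          isUnit_iff_ne_zero] at hb
        exact hb h
      push_cast
      exact (add_le_add (ih ha) hb').trans MvPowerSeries.le_order_mul
    · exact (le_min ha hb).trans MvPowerSeries.min_order_le_add

/-- The divided power monomial `x^[a]`, the functional dual to `α^a`:
it takes a power series to its coefficient at `α^a`. -/
def dpMonomial (a : Fin n →₀ ℕ) : P k n :=
  ⟨MvPowerSeries.coeff a, a.degree + 1, fun σ hσ =>
    MvPowerSeries.coeff_of_lt_order <| lt_of_lt_of_le
      (by exact_mod_cast Nat.lt_succ_self _) (le_order_of_mem_pow hσ)⟩

/-- The coefficient `⟨α^a, f⟩` of `x^[a]` in `f`. -/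
def dpCoeff (f : P k n) (a : Fin n →₀ ℕ) : k := f.1 (MvPowerSeries.monomial a 1)

theorem dpCoeff_dpMonomial (a b : Fin n →₀ ℕ) :
    dpCoeff (dpMonomial a : P k n) b = if a = b then 1 else 0 := by
  classical
  exact MvPowerSeries.coeff_monomial a b 1

theorem monomial_mem_pow (a : Fin n →₀ ℕ) :
    (MvPowerSeries.monomial a 1 : S k n) ∈ maxIdeal k n ^ a.degree := by
  have hX : ∀ i, (MvPowerSeries.X i : S k n) ∈ maxIdeal k n := fun i => by
    rw [IsLocalRing.mem_maximalIdeal, mem_nonunits_iff, MvPowerSeries.isUnit_iff_constantCoeff]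
    simp
  induction a using Finsupp.induction_linear with
  | zero => simp
  | add a b ha hb =>
    have h : (MvPowerSeries.monomial (a + b) 1 : S k n) =
        MvPowerSeries.monomial a 1 * MvPowerSeries.monomial b 1 := by
      rw [MvPowerSeries.monomial_mul_monomial, one_mul]
    rw [h, map_add, pow_add]
    exact Ideal.mul_mem_mul ha hb
  | single i m =>
    rw [Finsupp.degree_single, ← MvPowerSeries.X_pow_eq]
    exact Ideal.pow_mem_pow (hX i) m

theorem finite_dpSupport (f : P k n) : {a | dpCoeff f a ≠ 0}.Finite := by
  obtain ⟨D, hD⟩ := f.2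
  refine (Finsupp.finite_of_degree_le (σ := Fin n) D).subset fun a ha => ?_
  by_contra h
  exact ha (hD _ (Ideal.pow_le_pow_right (le_of_not_ge h) (monomial_mem_pow a)))

/-- The degree of `f ∈ P`, where `x^[a]` has degree `∑ aᵢ`; the degree of `0` is `⊥`. -/
def degree (f : P k n) : WithBot ℕ :=
  (finite_dpSupport f).toFinset.sup fun a => (a.degree : WithBot ℕ)

/-- The homogeneous part of degree `e` of `f ∈ P`. -/
def homogPart (e : ℕ) (f : P k n) : P k n :=
  ∑ a ∈ Finset.univ.finsuppAntidiag e, dpCoeff f a • dpMonomial a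

variable (k n)

/-- The group `𝔾⁺ = Aut⁺(S) ⋉ (1 + 𝔪)`, inside the group of `k`-linear automorphisms of `S`:
it is generated by the `k`-algebra automorphisms `φ` of `S` with `φ(αᵢ) - αᵢ ∈ 𝔪²` for all `i`
and by the multiplications by elements of `1 + 𝔪`. -/
def unipotentGroup : Subgroup (S k n ≃ₗ[k] S k n) :=
  Subgroup.closure
    ({L | ∃ φ : S k n ≃ₐ[k] S k n,
        (∀ i, φ (MvPowerSeries.X i) - MvPowerSeries.X i ∈ maxIdeal k n ^ 2) ∧
          L = φ.toLinearEquiv} ∪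
      {L | ∃ s : S k n, s - 1 ∈ maxIdeal k n ∧ ∀ τ, L τ = s * τ})

/-- `𝔞𝔲𝔱⁺`: the `k`-derivations `D` of `S` with `D(𝔪) ⊆ 𝔪²`, as linear endomorphisms of `S`. -/
def unipotentDerivations : Submodule k (Module.End k (S k n)) where
  carrier := {L | ∃ D : Derivation k (S k n) (S k n),
    (∀ σ ∈ maxIdeal k n, D σ ∈ maxIdeal k n ^ 2) ∧ L = D}
  zero_mem' := ⟨0, fun _ _ => by simp, rfl⟩
  add_mem' := by
    rintro _ _ ⟨D, hD, rfl⟩ ⟨E, hE, rfl⟩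
    exact ⟨D + E, fun σ hσ => Ideal.add_mem _ (hD σ hσ) (hE σ hσ), rfl⟩
  smul_mem' := by
    rintro c _ ⟨D, hD, rfl⟩
    exact ⟨c • D, fun σ hσ => Submodule.smul_of_tower_mem _ c (hD σ hσ), rfl⟩

/-- `𝔤⁺ = 𝔞𝔲𝔱⁺ + 𝔪`, where `𝔪` acts on `S` by multiplication. -/
def unipotentTangent : Submodule k (Module.End k (S k n)) :=
  unipotentDerivations k n ⊔
    ((maxIdeal k n).restrictScalars k).map (LinearMap.mul k (S k n))

variable {k n}

/-- The orbit `𝔾⁺ f`, where `L ∈ 𝔾⁺` acts through the dual map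
`L^∨`, `⟨σ, L^∨ f⟩ = ⟨L σ, f⟩`. -/
def unipotentOrbit (f : P k n) : Set (P k n) :=
  {h | ∃ L ∈ unipotentGroup k n, h.1 = (L : S k n →ₗ[k] S k n).dualMap f.1}

/-- The space `𝔤⁺ f = {L^∨ f | L ∈ 𝔤⁺}`. -/
def tangentSpace (f : P k n) : Submodule k (Module.Dual k (S k n)) :=
  (unipotentTangent k n).map (LinearMap.compRight k f.1)

/-- `W^⊥ = {σ ∈ S | ⟨σ, w⟩ = 0 for all w ∈ W}`. -/
abbrev perp (W : Submodule k (Module.Dual k (S k n))) : Submodule k (S k n) :=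
  W.dualCoannihilator

/-- The degree-`i` part of a subspace of `S`: its homogeneous elements of degree `i`. -/
def gradedPart (i : ℕ) (V : Submodule k (S k n)) : Set (S k n) :=
  {σ | σ ∈ V ∧ MvPowerSeries.IsHomogeneous σ i}

end

end Macaulay

namespace Macaulay

open MvPowerSeries

variable {k : Type*} [Field k] {n : ℕ}

/-! The components of `f` in degrees d-1, d-2, …, t are removed one at a time by elements of 𝔾⁺.
Suppose h lies in the orbit and agrees with F on 𝔪^(e+1), where t ≤ e < d. The group preserves
apolar algebras up to isomorphism, so Apolar(h) and Apolar(F) have equal dimension, and every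
homogeneous element of I is then an initial form from Ann(h) (`exists_mem_apolarIdeal_initialForm`).
If x, y ∈ I are homogeneous with degrees adding up to e, lift x to v ∈ Ann(h); then h(xy) =
-h((v-x)y) = -F((v-x)y) = 0. So h kills (I²)_e (`apply_homogeneousComponent_eq_zero_of_mem_sq`). By
hypothesis (I²)_e is ((𝔤⁺F)^⊥)_e, and finite-dimensional duality yields L = D + s in 𝔤⁺ with F(Lτ) =
h(τ) for τ of degree e (`exists_unipotentTangent_apply_eq`). With q = d-e, the substitution αᵢ ↦ αᵢ
- D(αᵢ)_{q+1}, followed by multiplication by 1 - s_q, is 1 - L to first order. Its further terms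
send degree e beyond degree d, where F vanishes, so it removes h in degree e and changes nothing
above (`exists_mem_unipotentOrbit_of_tangent`). -/

/-! ### Powers of 𝔪 and homogeneous components -/

theorem X_mem_maxIdeal (i : Fin n) : (X i : S k n) ∈ maxIdeal k n := by
  rw [IsLocalRing.mem_maximalIdeal, mem_nonunits_iff, isUnit_iff_constantCoeff]
  simp

/-- Each nonconstant monomial is divided by the first variable occurring in it, so it contributes to
exactly one `ρ i`, in degree one less. -/
theorem exists_eq_sum_X_mul (σ : S k n) (hσ : constantCoeff σ = 0) (D : ℕ)
    (h : ∀ a : Fin n →₀ ℕ, a.degree < D + 1 → coeff a σ = 0) :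
    ∃ ρ : Fin n → S k n, σ = ∑ i, X i * ρ i ∧
      ∀ i, ∀ a : Fin n →₀ ℕ, a.degree < D → coeff a (ρ i) = 0 := by
  classical
  refine ⟨fun i b => if ∀ j < i, b j = 0 then coeff (b + Finsupp.single i 1) σ else 0, ?_, ?_⟩
  · ext c
    have key : ∀ i : Fin n, coeff c (X i * (show S k n from fun b =>
        if ∀ j < i, b j = 0 then coeff (b + Finsupp.single i 1) σ else 0)) =
        if c i ≠ 0 ∧ ∀ j < i, c j = 0 then coeff c σ else 0 := by
      intro i
      rw [X_def, coeff_monomial_mul, one_mul]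
      have hle : Finsupp.single i 1 ≤ c ↔ c i ≠ 0 := by
        rw [Finsupp.single_le_iff]; omega
      by_cases hi : c i = 0
      · rw [if_neg (by simpa [hle] using hi), if_neg (by simp [hi])]
      · rw [if_pos (hle.2 hi)]
        change (if ∀ j < i, (c - Finsupp.single i 1 : Fin n →₀ ℕ) j = 0 then
          coeff (c - Finsupp.single i 1 + Finsupp.single i 1) σ else 0) = _
        rw [tsub_add_cancel_of_le (hle.2 hi)]
        refine if_congr ?_ rfl rfl
        simp only [ne_eq, hi, not_false_eq_true, true_and]
        refine forall₂_congr fun j hj => ?_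
        rw [show (c - Finsupp.single i 1 : Fin n →₀ ℕ) j = c j - Finsupp.single i 1 j from rfl,
          Finsupp.single_eq_of_ne (ne_of_lt hj), tsub_zero]
    rw [map_sum, Finset.sum_congr rfl fun i _ => key i]
    by_cases hc : c = 0
    · subst hc
      simpa using hσ
    · have hne : c.support.Nonempty := Finsupp.support_nonempty_iff.2 hc
      have hmin : ∀ j < c.support.min' hne, c j = 0 := fun j hj => by
        by_contra hcj
        exact absurd (c.support.min'_le j (Finsupp.mem_support_iff.2 hcj)) (not_le.2 hj)
      have hmem : c (c.support.min' hne) ≠ 0 :=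
        Finsupp.mem_support_iff.1 (c.support.min'_mem hne)
      rw [Finset.sum_eq_single (c.support.min' hne)]
      · rw [if_pos ⟨hmem, hmin⟩]
      · rintro j - hj
        refine if_neg fun ⟨h₁, h₂⟩ => ?_
        rcases lt_or_gt_of_ne hj with h | h
        · exact h₁ (hmin j h)
        · exact hmem (h₂ _ h)
      · simp
  · intro i a ha
    change (if ∀ j < i, a j = 0 then coeff (a + Finsupp.single i 1) σ else 0) = 0
    rw [h, ite_self]
    rw [map_add, Finsupp.degree_single]
    omega

theorem mem_maxIdeal_pow_iff {D : ℕ} {σ : S k n} :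
    σ ∈ maxIdeal k n ^ D ↔ ∀ a : Fin n →₀ ℕ, a.degree < D → coeff a σ = 0 := by
  refine ⟨fun h a ha => coeff_of_lt_order
    (lt_of_lt_of_le (by exact_mod_cast ha) (le_order_of_mem_pow h)), fun h => ?_⟩
  induction D generalizing σ with
  | zero => simp
  | succ D ih =>
    obtain ⟨ρ, hρ, hρ'⟩ := exists_eq_sum_X_mul σ (by simpa using h 0 (by simp)) D h
    rw [hρ, pow_succ']
    exact Ideal.sum_mem _ fun i _ => Ideal.mul_mem_mul (X_mem_maxIdeal i) (ih (hρ' i))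

theorem exists_eq_sum_X_mul_of_mem {D : ℕ} {σ : S k n} (hσ : σ ∈ maxIdeal k n ^ (D + 1)) :
    ∃ ρ : Fin n → S k n, σ = ∑ i, X i * ρ i ∧ ∀ i, ρ i ∈ maxIdeal k n ^ D := by
  have h := mem_maxIdeal_pow_iff.1 hσ
  obtain ⟨ρ, hρ, hρ'⟩ := exists_eq_sum_X_mul σ (by simpa using h 0 (by simp)) D h
  exact ⟨ρ, hρ, fun i => mem_maxIdeal_pow_iff.2 (hρ' i)⟩

theorem exists_eq_C_add_sum_X_mul (σ : S k n) :
    ∃ (c : k) (ρ : Fin n → S k n), σ = algebraMap k _ c + ∑ i, X i * ρ i := by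
  have : σ - algebraMap k _ (constantCoeff σ) ∈ maxIdeal k n ^ (0 + 1) := by
    rw [mem_maxIdeal_pow_iff]
    intro a ha
    obtain rfl : a = 0 := by
      rw [← Finsupp.degree_eq_zero_iff]; omega
    simp [MvPowerSeries.algebraMap_apply]
  obtain ⟨ρ, hρ, -⟩ := exists_eq_sum_X_mul_of_mem this
  exact ⟨_, ρ, by rw [← hρ, add_sub_cancel]⟩

theorem eq_zero_of_forall_mem_maxIdeal_pow {σ : S k n} (h : ∀ D, σ ∈ maxIdeal k n ^ D) :
    σ = 0 := by
  ext a
  exact mem_maxIdeal_pow_iff.1 (h (a.degree + 1)) a (Nat.lt_succ_self _)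

theorem mem_maxIdeal_pow_iff_homogeneousComponent {D : ℕ} {σ : S k n} :
    σ ∈ maxIdeal k n ^ D ↔ ∀ e < D, homogeneousComponent e σ = 0 := by
  rw [mem_maxIdeal_pow_iff]
  constructor
  · intro h e he
    ext a
    rw [coeff_homogeneousComponent]
    split_ifs with ha
    · rw [h a (ha ▸ he), map_zero]
    · rw [map_zero]
  · intro h a ha
    have := congrArg (coeff a) (h _ ha)
    rwa [coeff_homogeneousComponent, if_pos rfl, map_zero] at this

theorem homogeneousComponent_homogeneousComponent (a b : ℕ) (σ : S k n) :
    homogeneousComponent a (homogeneousComponent b σ) =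
      if a = b then homogeneousComponent a σ else 0 := by
  ext c
  split_ifs with h
  · subst h
    simp +contextual [coeff_homogeneousComponent]
  · simp only [coeff_homogeneousComponent, map_zero]
    split_ifs <;> [omega; rfl; rfl]

theorem homogeneousComponent_eq_of_isHomogeneous {σ : S k n} {a : ℕ} (h : IsHomogeneous σ a) :
    homogeneousComponent a σ = σ := (isHomogeneous_iff_eq_homogeneousComponent.1 h).symm

theorem mem_pow_of_isHomogeneous {σ : S k n} {a : ℕ} (h : IsHomogeneous σ a) :
    σ ∈ maxIdeal k n ^ a :=
  mem_maxIdeal_pow_iff.2 fun _ hb => h.coeff_eq_zero hb.ne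

theorem homogeneousComponent_mul_of_isHomogeneous {σ : S k n} {a : ℕ} (h : IsHomogeneous σ a)
    (b : ℕ) (τ : S k n) :
    homogeneousComponent (a + b) (σ * τ) = σ * homogeneousComponent b τ := by
  classical
  ext c
  rw [coeff_homogeneousComponent]
  split_ifs with hc
  · rw [coeff_mul, coeff_mul]
    refine Finset.sum_congr rfl fun x hx => ?_
    rw [Finset.HasAntidiagonal.mem_antidiagonal] at hx
    by_cases hx1 : x.1.degree = a
    · rw [coeff_homogeneousComponent, if_pos]
      rw [← hx, map_add] at hc
      omega
    · rw [h.coeff_eq_zero hx1, zero_mul, zero_mul]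
  · exact (IsHomogeneous.coeff_eq_zero
      (IsHomogeneous.mul h (isHomogeneous_homogeneousComponent τ b)) hc).symm

theorem sub_sum_homogeneousComponent_mem (σ : S k n) (N : ℕ) :
    σ - ∑ e ∈ Finset.range N, homogeneousComponent e σ ∈ maxIdeal k n ^ N := by
  rw [mem_maxIdeal_pow_iff]
  intro a ha
  rw [map_sub, map_sum, Finset.sum_congr rfl fun e _ => coeff_homogeneousComponent e a σ]
  simp [ha]

theorem sub_homogeneousComponent_mem {σ : S k n} {e : ℕ} (hσ : σ ∈ maxIdeal k n ^ e) :
    σ - homogeneousComponent e σ ∈ maxIdeal k n ^ (e + 1) := by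
  rw [mem_maxIdeal_pow_iff] at hσ ⊢
  intro a ha
  rw [map_sub, coeff_homogeneousComponent]
  split_ifs with h
  · exact sub_self _
  · rw [hσ a (by omega), sub_zero]

theorem isHomogeneous_monomial (a : Fin n →₀ ℕ) (c : k) :
    IsHomogeneous (monomial a c : S k n) a.degree := by
  classical
  rw [isHomogeneous_iff_eq_homogeneousComponent]
  ext b
  rw [coeff_homogeneousComponent, coeff_monomial]
  split_ifs <;> simp_all

theorem homogeneousComponent_eq_sum (e : ℕ) (σ : S k n) :
    homogeneousComponent e σ =
      ∑ a ∈ Finset.univ.finsuppAntidiag e, coeff a σ • (monomial a 1 : S k n) := by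
  classical
  ext b
  rw [map_sum, coeff_homogeneousComponent]
  simp only [coeff_smul, coeff_monomial, mul_ite, mul_one, mul_zero, Finset.sum_ite_eq,
    Finset.mem_finsuppAntidiag, Finset.subset_univ, and_true, Finsupp.degree_eq_sum]

/-! ### Degrees and annihilators in P -/

theorem P_apply_homogeneousComponent (f : P k n) (e : ℕ) (σ : S k n) :
    f.1 (homogeneousComponent e σ) = (homogPart e f).1 σ := by
  rw [homogeneousComponent_eq_sum, map_sum, homogPart, Submodule.coe_sum, LinearMap.sum_apply]
  refine Finset.sum_congr rfl fun a _ => ?_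
  rw [map_smul, smul_eq_mul, mul_comm]
  rfl

theorem vanishing_iff_dpCoeff {f : P k n} {t : ℕ} :
    (∀ σ ∈ maxIdeal k n ^ t, f.1 σ = 0) ↔ ∀ a : Fin n →₀ ℕ, t ≤ a.degree → dpCoeff f a = 0 := by
  constructor
  · exact fun h a ha => h _ (Ideal.pow_le_pow_right ha (monomial_mem_pow a))
  · intro h σ hσ
    obtain ⟨N, hN⟩ := f.2
    have h₁ := hN _ (sub_sum_homogeneousComponent_mem σ N)
    rw [map_sub, sub_eq_zero] at h₁
    rw [h₁, map_sum]
    refine Finset.sum_eq_zero fun e _ => ?_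
    by_cases he : e < t
    · rw [mem_maxIdeal_pow_iff_homogeneousComponent.1 hσ e he, map_zero]
    · rw [homogeneousComponent_eq_sum, map_sum]
      refine Finset.sum_eq_zero fun a ha => ?_
      rw [map_smul, show f.1 (monomial a 1) = 0 from h a ?_, smul_zero]
      rw [Finset.mem_finsuppAntidiag] at ha
      rw [Finsupp.degree_eq_sum, ha.1]
      omega

/-- Lets the whole argument run with vanishing on powers of 𝔪 instead of degrees. For `t = 0` both
sides say that `f` is zero. -/
theorem degree_lt_iff_vanishing {f : P k n} {t : ℕ} :
    degree f < t ↔ ∀ σ ∈ maxIdeal k n ^ t, f.1 σ = 0 := by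
  rw [vanishing_iff_dpCoeff, degree]
  refine (Finset.sup_lt_iff (WithBot.bot_lt_coe t)).trans ?_
  simp only [Set.Finite.mem_toFinset, Set.mem_ofPred_eq]
  refine forall_congr' fun a => ?_
  rw [← not_imp_not, not_lt, not_not]
  exact imp_congr_left WithBot.coe_le_coe

theorem mem_apolarIdeal_iff {f : P k n} {σ : S k n} :
    σ ∈ apolarIdeal f ↔ ∀ τ, f.1 (τ * σ) = 0 := by
  change contract σ f = 0 ↔ _
  rw [Subtype.ext_iff, LinearMap.ext_iff]
  rfl

/-! ### Elements of 𝔾⁺ and their orbits -/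

/-- Splitting off one variable from σ at a time makes the difference a twisted Leibniz sum. Each
factor φ(αᵢ) ∈ 𝔪 gains one degree, so no continuity of φ has to be assumed. -/
theorem algHom_sub_self_mem {φ : S k n →ₐ[k] S k n} {p : ℕ}
    (h : ∀ i, φ (X i) - X i ∈ maxIdeal k n ^ (p + 1)) {M : ℕ} {σ : S k n}
    (hσ : σ ∈ maxIdeal k n ^ M) : φ σ - σ ∈ maxIdeal k n ^ (M + p) := by
  have hX : ∀ i, φ (X i) ∈ maxIdeal k n := fun i => by
    have := Ideal.add_mem _ (Ideal.pow_le_self (Nat.succ_ne_zero p) (h i)) (X_mem_maxIdeal i)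
    rwa [sub_add_cancel] at this
  have expand : ∀ ρ : Fin n → S k n, φ (∑ i, X i * ρ i) - ∑ i, X i * ρ i =
      ∑ i, (φ (X i) * (φ (ρ i) - ρ i) + (φ (X i) - X i) * ρ i) := fun ρ => by
    rw [map_sum, ← Finset.sum_sub_distrib]
    exact Finset.sum_congr rfl fun i _ => by rw [map_mul]; ring
  have base : ∀ j ≤ p, ∀ τ : S k n, φ τ - τ ∈ maxIdeal k n ^ j := by
    intro j
    induction j with
    | zero => simp
    | succ j ih =>
      intro hj τ
      obtain ⟨c, ρ, rfl⟩ := exists_eq_C_add_sum_X_mul τ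
      rw [map_add, AlgHom.commutes, add_sub_add_left_eq_sub, expand]
      refine Ideal.sum_mem _ fun i _ => Ideal.add_mem _ ?_ ?_
      · rw [pow_succ']
        exact Ideal.mul_mem_mul (hX i) (ih (by omega) _)
      · exact Ideal.mul_mem_right _ _ (Ideal.pow_le_pow_right (by omega) (h i))
  induction M generalizing σ with
  | zero => simpa using base p le_rfl σ
  | succ M ih =>
    obtain ⟨ρ, rfl, hρ⟩ := exists_eq_sum_X_mul_of_mem hσ
    rw [expand]
    refine Ideal.sum_mem _ fun i _ => Ideal.add_mem _ ?_ ?_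
    · rw [show M + 1 + p = M + p + 1 by omega, pow_succ']
      exact Ideal.mul_mem_mul (hX i) (ih (hρ i))
    · rw [show M + 1 + p = p + 1 + M by omega, pow_add]
      exact Ideal.mul_mem_mul (h i) (hρ i)

/-- `N = 1 - L` raises the order, so the Neumann series ∑ Nʲ converges 𝔪-adically and inverts `L`.
-/
theorem bijective_of_sub_self_mem (L : S k n →ₗ[k] S k n)
    (h : ∀ M, ∀ σ ∈ maxIdeal k n ^ M, L σ - σ ∈ maxIdeal k n ^ (M + 1)) :
    Function.Bijective L := by
  constructor
  · rw [injective_iff_map_eq_zero]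
    intro σ hσ
    refine eq_zero_of_forall_mem_maxIdeal_pow fun D => ?_
    induction D with
    | zero => simp
    | succ D ih => simpa [hσ] using h D σ ih
  · intro τ
    set N : S k n →ₗ[k] S k n := LinearMap.id - L with hN
    have hNm : ∀ M, ∀ σ ∈ maxIdeal k n ^ M, N σ ∈ maxIdeal k n ^ (M + 1) := fun M σ hσ => by
      have := Ideal.neg_mem_iff _ |>.2 (h M σ hσ)
      rwa [neg_sub] at this
    have hpow : ∀ j, (N ^ j) τ ∈ maxIdeal k n ^ j := fun j => by
      induction j with
      | zero => simp
      | succ j ih =>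
        rw [pow_succ' N, Module.End.mul_apply]
        exact hNm j _ ih
    -- The sum of the series, coefficient by coefficient: terms with j > deg a have no coefficient
    -- at `a`.
    let σ : S k n := fun a => coeff a (∑ j ∈ Finset.range (a.degree + 1), (N ^ j) τ)
    have hσ : ∀ M, σ - ∑ j ∈ Finset.range M, (N ^ j) τ ∈ maxIdeal k n ^ M := fun M => by
      rw [mem_maxIdeal_pow_iff]
      intro a ha
      rw [map_sub, sub_eq_zero]
      change coeff a (∑ j ∈ Finset.range (a.degree + 1), (N ^ j) τ) = _
      rw [map_sum, map_sum]
      refine Finset.sum_subset (Finset.range_mono ha) fun j _ hj => ?_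
      exact mem_maxIdeal_pow_iff.1 (hpow j) a (by simpa using hj)
    refine ⟨σ, sub_eq_zero.1 (eq_zero_of_forall_mem_maxIdeal_pow fun M => ?_)⟩
    have hL : ∀ ρ, L ρ = ρ - N ρ := fun ρ => by simp [hN]
    have htel : L (∑ j ∈ Finset.range M, (N ^ j) τ) = τ - (N ^ M) τ := by
      rw [map_sum, Finset.sum_congr rfl fun j _ => hL _]
      have := Finset.sum_range_sub' (fun j => (N ^ j) τ) M
      simpa [pow_succ', Module.End.mul_apply] using this
    have h₁ : L (σ - ∑ j ∈ Finset.range M, (N ^ j) τ) ∈ maxIdeal k n ^ M := by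
      rw [hL]
      exact Ideal.sub_mem _ (hσ M) (Ideal.pow_le_pow_right (Nat.le_succ M) (hNm M _ (hσ M)))
    have h₂ := Ideal.sub_mem _ h₁ (hpow M)
    rw [map_sub, htel] at h₂
    convert h₂ using 1
    abel

theorem exists_mem_unipotentGroup {p : ℕ} (hp : 1 ≤ p) (s : Fin n → S k n)
    (hs : ∀ i, s i ∈ maxIdeal k n ^ (p + 1)) (u : S k n) (hu : u ∈ maxIdeal k n ^ p) :
    ∃ L ∈ unipotentGroup k n, ∃ φ : S k n →ₐ[k] S k n,
      (∀ i, φ (X i) = X i - s i) ∧ ∀ τ, L τ = (1 - u) * φ τ := by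
  have hsub : HasSubst fun i => X i - s i := by
    refine hasSubst_of_constantCoeff_zero fun i => ?_
    have := mem_maxIdeal_pow_iff.1 (hs i) 0 (by simp)
    simpa using this
  have hX : ∀ i, substAlgHom (R := k) hsub (X i) = X i - s i := substAlgHom_X hsub
  have hφ : ∀ i, substAlgHom (R := k) hsub (X i) - X i ∈ maxIdeal k n ^ (p + 1) := fun i => by
    rw [hX, sub_sub_cancel_left]
    exact (Ideal.neg_mem_iff _).2 (hs i)
  have hφb := bijective_of_sub_self_mem (substAlgHom (R := k) hsub).toLinearMap fun M σ hσ =>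
    Ideal.pow_le_pow_right (by omega) (algHom_sub_self_mem hφ hσ)
  have hub := bijective_of_sub_self_mem (LinearMap.mulLeft k (1 - u)) fun M σ hσ => by
    have : LinearMap.mulLeft k (1 - u) σ - σ = -(u * σ) := by
      rw [LinearMap.mulLeft_apply]; ring
    rw [this, pow_succ']
    exact (Ideal.neg_mem_iff _).2
      (Ideal.mul_mem_mul (Ideal.pow_le_self (by omega) hu) hσ)
  let Φ : S k n ≃ₐ[k] S k n := AlgEquiv.ofBijective (substAlgHom (R := k) hsub) hφb
  let U : S k n ≃ₗ[k] S k n := LinearEquiv.ofBijective (LinearMap.mulLeft k (1 - u)) hub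
  refine ⟨U * Φ.toLinearEquiv, mul_mem (Subgroup.subset_closure (Or.inr ⟨1 - u, ?_, fun τ => rfl⟩))
    (Subgroup.subset_closure (Or.inl ⟨Φ, fun i => ?_, rfl⟩)), substAlgHom hsub, hX, fun τ => rfl⟩
  · rw [sub_sub_cancel_left]
    exact (Ideal.neg_mem_iff _).2 (Ideal.pow_le_self (by omega) hu)
  · exact Ideal.pow_le_pow_right (by omega) (hφ i)

/-- The form "unit times automorphism" is stable under composition, since u₁φ₁(u₂φ₂(τ)) =
u₁φ₁(u₂)·φ₁φ₂(τ), and under inversion. -/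
theorem exists_isUnit_mul_algEquiv {L : S k n ≃ₗ[k] S k n} (hL : L ∈ unipotentGroup k n) :
    ∃ (u : S k n) (φ : S k n ≃ₐ[k] S k n), IsUnit u ∧ ∀ τ, L τ = u * φ τ := by
  induction hL using Subgroup.closure_induction with
  | mem L hL =>
    rcases hL with ⟨φ, -, rfl⟩ | ⟨s, hs, hL⟩
    · exact ⟨1, φ, isUnit_one, fun τ => (one_mul _).symm⟩
    · refine ⟨s, AlgEquiv.refl, ?_, hL⟩
      by_contra hn
      have h1 := Ideal.sub_mem _ ((IsLocalRing.mem_maximalIdeal s).2 hn) hs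
      rw [sub_sub_cancel] at h1
      exact (IsLocalRing.mem_maximalIdeal _).1 h1 isUnit_one
  | one => exact ⟨1, AlgEquiv.refl, isUnit_one, fun τ => (one_mul _).symm⟩
  | mul L₁ L₂ _ _ h₁ h₂ =>
    obtain ⟨u₁, φ₁, hu₁, h₁⟩ := h₁
    obtain ⟨u₂, φ₂, hu₂, h₂⟩ := h₂
    refine ⟨u₁ * φ₁ u₂, φ₂.trans φ₁, hu₁.mul (hu₂.map φ₁), fun τ => ?_⟩
    rw [LinearEquiv.mul_apply, h₁, h₂, map_mul, mul_assoc]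
    rfl
  | inv L _ h =>
    obtain ⟨u, φ, hu, h⟩ := h
    obtain ⟨v, hv⟩ := hu.exists_right_inv
    refine ⟨φ.symm v, φ.symm, (IsUnit.of_mul_eq_one u (by rw [mul_comm, hv])).map φ.symm,
      fun τ => ?_⟩
    rw [← map_mul]
    apply L.injective
    refine (L.apply_symm_apply τ).trans ?_
    rw [h, AlgEquiv.apply_symm_apply, ← mul_assoc, hv, one_mul]

/-- With L = uφ one has h(τσ) = f(uφ(τ)·φ(σ)). As τ varies, uφ(τ) runs through all of S, so Ann(h)
is the preimage of Ann(f) under φ. -/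
theorem nonempty_apolar_algEquiv {f h : P k n} (hh : h ∈ unipotentOrbit f) :
    Nonempty (Apolar f ≃ₐ[k] Apolar h) := by
  obtain ⟨L, hL, hLh⟩ := hh
  obtain ⟨u, φ, hu, hφ⟩ := exists_isUnit_mul_algEquiv hL
  obtain ⟨v, hv⟩ := hu.exists_right_inv
  have key : ∀ σ, σ ∈ apolarIdeal h ↔ φ σ ∈ apolarIdeal f := fun σ => by
    have hval : ∀ τ, h.1 (τ * σ) = f.1 (u * φ τ * φ σ) := fun τ => by
      rw [hLh, mul_assoc, ← map_mul, ← hφ]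
      rfl
    simp only [mem_apolarIdeal_iff, hval]
    refine ⟨fun H τ => ?_, fun H τ => H _⟩
    have := H (φ.symm (v * τ))
    rwa [AlgEquiv.apply_symm_apply, ← mul_assoc u v τ, hv, one_mul] at this
  refine ⟨(Ideal.quotientEquivAlg (apolarIdeal h) (apolarIdeal f) φ ?_).symm⟩
  refine le_antisymm (fun σ hσ => ?_) (Ideal.map_le_iff_le_comap.2 fun ρ hρ => (key ρ).1 hρ)
  rw [← φ.apply_symm_apply σ] at hσ ⊢
  exact Ideal.mem_map_of_mem _ ((key _).2 hσ)

theorem self_mem_unipotentOrbit (f : P k n) : f ∈ unipotentOrbit f :=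
  ⟨1, one_mem _, rfl⟩

theorem mem_unipotentOrbit_trans {f g h : P k n} (hg : g ∈ unipotentOrbit f)
    (hh : h ∈ unipotentOrbit g) : h ∈ unipotentOrbit f := by
  obtain ⟨L₁, h₁, hg⟩ := hg
  obtain ⟨L₂, h₂, hh⟩ := hh
  exact ⟨L₁ * L₂, mul_mem h₁ h₂, by rw [hh, hg]; rfl⟩

theorem finiteDimensional_range_homogeneousComponent (e : ℕ) :
    FiniteDimensional k (LinearMap.range (homogeneousComponent e : S k n →ₗ[k] S k n)) := by
  classical
  let T : Finset (S k n) := (Finset.univ.finsuppAntidiag e).image fun a => monomial a 1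
  have hle : LinearMap.range (homogeneousComponent e : S k n →ₗ[k] S k n) ≤
      Submodule.span k (T : Set (S k n)) := by
    rintro _ ⟨σ, rfl⟩
    rw [homogeneousComponent_eq_sum]
    exact Submodule.sum_mem _ fun a ha => Submodule.smul_mem _ _
      (Submodule.subset_span (Finset.mem_coe.2 (Finset.mem_image_of_mem _ ha)))
  exact Submodule.finiteDimensional_of_le hle

/-- `f` kills some 𝔪^D, so truncations represent all classes. Without finiteness, equality of
`finrank` would carry no information. -/
theorem finiteDimensional_apolar (f : P k n) : FiniteDimensional k (Apolar f) := by
  obtain ⟨D, hD⟩ := f.2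
  have := fun e => finiteDimensional_range_homogeneousComponent (k := k) (n := n) e
  let V : Submodule k (S k n) := (Finset.range D).sup fun e =>
    LinearMap.range (homogeneousComponent e : S k n →ₗ[k] S k n)
  have hV : FiniteDimensional k V := Submodule.finite_finset_sup _ _
  refine Module.Finite.of_surjective
    ((Ideal.Quotient.mkₐ k (apolarIdeal f)).toLinearMap ∘ₗ V.subtype) fun x => ?_
  obtain ⟨σ, rfl⟩ := Ideal.Quotient.mk_surjective x
  refine ⟨⟨∑ e ∈ Finset.range D, homogeneousComponent e σ, Submodule.sum_mem _ fun e he =>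
    Finset.le_sup (f := fun e =>
      LinearMap.range (homogeneousComponent e : S k n →ₗ[k] S k n)) he ⟨σ, rfl⟩⟩, ?_⟩
  refine (Ideal.Quotient.eq.2 ?_).symm
  rw [mem_apolarIdeal_iff]
  exact fun τ => hD _ (Ideal.mul_mem_left _ _ (sub_sum_homogeneousComponent_mem σ D))

/-! ### Initial forms of Ann(f) and the homogeneous ideal Ann(F) -/

section Homogeneous

variable {F : P k n} {d : ℕ} (hF : ∀ σ, F.1 σ = F.1 (homogeneousComponent d σ))
include hF

theorem vanishing_of_homogeneous {N : ℕ} (hN : d < N) {σ : S k n}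
    (hσ : σ ∈ maxIdeal k n ^ N) : F.1 σ = 0 := by
  rw [hF, mem_maxIdeal_pow_iff_homogeneousComponent.1 hσ d hN, map_zero]

/-- F sees only degree d, so pairing the degree-`a` part of σ with any τ involves only the
degree-(d-a) part of τ. For `a > d` the product is out of reach of F. -/
theorem homogeneousComponent_mem_apolarIdeal_of {a : ℕ} {σ : S k n}
    (h : a ≤ d → ∀ τ, IsHomogeneous τ (d - a) → F.1 (τ * σ) = 0) :
    homogeneousComponent a σ ∈ apolarIdeal F := by
  rw [mem_apolarIdeal_iff]
  intro τ
  have ha : IsHomogeneous (homogeneousComponent a σ) a :=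
    isHomogeneous_homogeneousComponent σ a
  by_cases hd : a ≤ d
  · have hτ : IsHomogeneous (homogeneousComponent (d - a) τ) (d - a) :=
      isHomogeneous_homogeneousComponent τ (d - a)
    have h₁ := h hd _ hτ
    have h₂ := homogeneousComponent_mul_of_isHomogeneous hτ a σ
    have h₃ := homogeneousComponent_mul_of_isHomogeneous ha (d - a) τ
    rw [Nat.sub_add_cancel hd] at h₂
    rw [Nat.add_sub_cancel' hd] at h₃
    rw [hF, mul_comm, h₃, mul_comm, ← h₂, ← hF, h₁]
  · exact vanishing_of_homogeneous hF (not_le.1 hd)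
      (Ideal.mul_mem_left _ _ (mem_pow_of_isHomogeneous ha))

theorem homogeneousComponent_mem_apolarIdeal {σ : S k n} (h : σ ∈ apolarIdeal F) (a : ℕ) :
    homogeneousComponent a σ ∈ apolarIdeal F :=
  homogeneousComponent_mem_apolarIdeal_of hF fun _ τ _ => mem_apolarIdeal_iff.1 h τ

theorem mem_apolarIdeal_of_homogeneousComponent {σ : S k n}
    (h : ∀ a, homogeneousComponent a σ ∈ apolarIdeal F) : σ ∈ apolarIdeal F := by
  have h₁ : σ - ∑ e ∈ Finset.range (d + 1), homogeneousComponent e σ ∈ apolarIdeal F := by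
    rw [mem_apolarIdeal_iff]
    exact fun τ => vanishing_of_homogeneous hF (Nat.lt_succ_self d)
      (Ideal.mul_mem_left _ _ (sub_sum_homogeneousComponent_mem σ _))
  have h₂ := Ideal.add_mem _ h₁ (Ideal.sum_mem _ fun e (_ : e ∈ Finset.range (d + 1)) => h e)
  rwa [sub_add_cancel] at h₂

/-- A degree-preserving linear projection of `S` with kernel `Ann(F)`. -/
theorem exists_homogeneous_projection : ∃ r : S k n →ₗ[k] S k n,
    (∀ σ ∈ apolarIdeal F, r σ = 0) ∧ (∀ σ, σ - r σ ∈ apolarIdeal F) ∧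
      ∀ a σ, homogeneousComponent a (r σ) = r (homogeneousComponent a σ) := by
  classical
  obtain ⟨q, hq₀, hq₁⟩ : ∃ q : S k n →ₗ[k] S k n,
      (∀ σ ∈ apolarIdeal F, q σ = 0) ∧ ∀ σ, σ - q σ ∈ apolarIdeal F := by
    let J := (apolarIdeal F).restrictScalars k
    obtain ⟨g, hg⟩ := LinearMap.exists_extend (LinearMap.id : J →ₗ[k] J)
    refine ⟨LinearMap.id - J.subtype ∘ₗ g, fun σ hσ => ?_, fun σ => ?_⟩
    · have := congrArg Subtype.val (LinearMap.congr_fun hg ⟨σ, hσ⟩)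
      exact sub_eq_zero.2 this.symm
    · have : σ - (LinearMap.id - J.subtype ∘ₗ g : S k n →ₗ[k] S k n) σ = g σ := by simp
      rw [this]
      exact (g σ).2
  -- The diagonal blocks of `q` for the grading. Degrees above d lie in Ann(F) already, so `r` may
  -- be zero there and the sum stays finite.
  let r : S k n →ₗ[k] S k n := ∑ a ∈ Finset.range (d + 1),
    homogeneousComponent a ∘ₗ q ∘ₗ homogeneousComponent a
  have hr : ∀ σ, r σ = ∑ a ∈ Finset.range (d + 1),
      homogeneousComponent a (q (homogeneousComponent a σ)) := fun σ => by
    simp only [r, LinearMap.sum_apply, LinearMap.comp_apply]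
  have hcr : ∀ a σ, homogeneousComponent a (r σ) =
      if a < d + 1 then homogeneousComponent a (q (homogeneousComponent a σ)) else 0 := by
    intro a σ
    rw [hr, map_sum]
    simp only [homogeneousComponent_homogeneousComponent, Finset.sum_ite_eq, Finset.mem_range]
  refine ⟨r, fun σ hσ => ?_, fun σ => ?_, fun a σ => ?_⟩
  · rw [hr]
    refine Finset.sum_eq_zero fun a _ => ?_
    rw [hq₀ _ (homogeneousComponent_mem_apolarIdeal hF hσ a), map_zero]
  · refine mem_apolarIdeal_of_homogeneousComponent hF fun a => ?_
    rw [map_sub, hcr]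
    split_ifs with ha
    · have := homogeneousComponent_mem_apolarIdeal hF (hq₁ (homogeneousComponent a σ)) a
      rwa [map_sub, homogeneousComponent_homogeneousComponent, if_pos rfl] at this
    · rw [sub_zero]
      exact homogeneousComponent_mem_apolarIdeal_of hF fun h => absurd h (by omega)
  · rw [hcr, hr]
    simp only [homogeneousComponent_homogeneousComponent]
    rw [Finset.sum_congr rfl fun b _ => show homogeneousComponent b
      (q (if b = a then homogeneousComponent b σ else 0)) = if a = b then
        homogeneousComponent b (q (homogeneousComponent b σ)) else 0 by
      by_cases h : a = b
      · subst h; simp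
      · rw [if_neg h, if_neg (Ne.symm h), map_zero, map_zero]]
    simp

variable {f : P k n} (hf : ∀ σ ∈ maxIdeal k n ^ d, f.1 σ = F.1 σ)
include hf

/-- For τ of degree d-a, the product τσ lies in 𝔪^d, where f and F agree. -/
theorem initialForm_mem_apolarIdeal {a : ℕ} {σ : S k n} (hσ : σ ∈ apolarIdeal f)
    (ha : σ ∈ maxIdeal k n ^ a) : homogeneousComponent a σ ∈ apolarIdeal F := by
  refine homogeneousComponent_mem_apolarIdeal_of hF fun had τ hτ => ?_
  rw [← hf, mem_apolarIdeal_iff.1 hσ]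
  have := Ideal.mul_mem_mul (mem_pow_of_isHomogeneous hτ) ha
  rwa [← pow_add, Nat.sub_add_cancel had] at this

/-- If `f` and its leading form `F` have apolar algebras of the same dimension, then every
homogeneous element of `Ann(F)` is the initial form of an element of `Ann(f)`. -/
theorem exists_mem_apolarIdeal_initialForm
    (hdim : Module.finrank k (Apolar f) = Module.finrank k (Apolar F))
    {a : ℕ} {u : S k n} (hu : u ∈ apolarIdeal F) (hua : IsHomogeneous u a) :
    ∃ v ∈ apolarIdeal f, v - u ∈ maxIdeal k n ^ (a + 1) := by
  obtain ⟨r, hr₀, hr₁, hr₂⟩ := exists_homogeneous_projection hF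
  have hrr : ∀ σ, r (r σ) = r σ := fun σ => by
    have := hr₀ _ (hr₁ σ)
    rw [map_sub, sub_eq_zero] at this
    exact this.symm
  -- Up to degree `a`, the lowest component of `r σ` lies in Ann(F), by passing to initial forms,
  -- and is fixed by `r`, which kills Ann(F). So it is zero.
  have key : ∀ (a : ℕ) (u : S k n), u ∈ apolarIdeal F → IsHomogeneous u a → ∀ σ,
      u - r σ ∈ apolarIdeal f → r σ ∈ maxIdeal k n ^ (a + 1) := by
    intro a u hu hua σ h
    have aux : ∀ c ≤ a + 1, r σ ∈ maxIdeal k n ^ c := by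
      intro c
      induction c with
      | zero => simp
      | succ c ih =>
        intro hc
        have hrc := ih (by omega)
        have h₁ := initialForm_mem_apolarIdeal hF hf h (a := c) (Ideal.sub_mem _
          (Ideal.pow_le_pow_right (by omega) (mem_pow_of_isHomogeneous hua)) hrc)
        rw [map_sub] at h₁
        have h₂ := Ideal.sub_mem _ (homogeneousComponent_mem_apolarIdeal hF hu c) h₁
        rw [sub_sub_cancel] at h₂
        have h₃ := hr₀ _ h₂
        rw [← hr₂, hrr] at h₃
        simpa [h₃] using sub_homogeneousComponent_mem hrc
    exact aux _ le_rfl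
  have := finiteDimensional_apolar f
  let mkf : S k n →ₗ[k] Apolar f := (Ideal.Quotient.mkₐ k (apolarIdeal f)).toLinearMap
  let mkF : S k n →ₗ[k] Apolar F := (Ideal.Quotient.mkₐ k (apolarIdeal F)).toLinearMap
  have hmkF : LinearMap.range mkF = ⊤ := LinearMap.range_eq_top.2 Ideal.Quotient.mk_surjective
  -- The image of `r` is a complement of Ann(F), and it meets Ann(f) trivially by `key` with `u =
  -- 0`. Equal dimensions then make it a complement of Ann(f) too, so `u` is congruent to some `r σ`
  -- modulo Ann(f).
  have hker : LinearMap.ker (mkf ∘ₗ r) = LinearMap.ker mkF := by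
    ext σ
    have e₁ : σ ∈ LinearMap.ker (mkf ∘ₗ r) ↔ r σ ∈ apolarIdeal f := Ideal.Quotient.eq_zero_iff_mem
    have e₂ : σ ∈ LinearMap.ker mkF ↔ σ ∈ apolarIdeal F := Ideal.Quotient.eq_zero_iff_mem
    rw [e₁, e₂]
    constructor
    · intro h
      have hz : r σ = 0 := eq_zero_of_forall_mem_maxIdeal_pow fun D =>
        Ideal.pow_le_pow_right (Nat.le_succ D) (key D 0 (Ideal.zero_mem _)
          (isHomogeneous_iff_eq_homogeneousComponent.2 (map_zero _).symm) σ
          (by rw [zero_sub]; exact (Ideal.neg_mem_iff _).2 h))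
      simpa [hz] using hr₁ σ
    · intro h
      rw [hr₀ σ h]
      exact Ideal.zero_mem _
  have hrange : LinearMap.range (mkf ∘ₗ r) = ⊤ := by
    apply Submodule.eq_top_of_finrank_eq
    rw [← (mkf ∘ₗ r).quotKerEquivRange.finrank_eq, hker, mkF.quotKerEquivRange.finrank_eq, hmkF,
      finrank_top, hdim]
  obtain ⟨σ, hσ⟩ := LinearMap.range_eq_top.1 hrange (mkf u)
  have hmem : u - r σ ∈ apolarIdeal f := Ideal.Quotient.eq.1 hσ.symm
  refine ⟨u - r σ, hmem, ?_⟩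
  rw [sub_sub_cancel_left]
  exact (Ideal.neg_mem_iff _).2 (key a u hu hua σ hmem)

omit hf

/-- Only one factor of a product xy has to be lifted to Ann(f). The error (v-x)y lies in 𝔪^(e+1),
where f is F, and F kills it because y ∈ Ann(F). -/
theorem apply_homogeneousComponent_eq_zero_of_mem_sq {e : ℕ} (he : e < d)
    (hf : ∀ σ ∈ maxIdeal k n ^ (e + 1), f.1 σ = F.1 σ)
    (hdim : Module.finrank k (Apolar f) = Module.finrank k (Apolar F))
    {σ : S k n} (hσ : σ ∈ apolarIdeal F ^ 2) : f.1 (homogeneousComponent e σ) = 0 := by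
  rw [pow_two] at hσ
  have hom : ∀ a b, a + b = e → ∀ x y : S k n, x ∈ apolarIdeal F → IsHomogeneous x a →
      y ∈ apolarIdeal F → IsHomogeneous y b → f.1 (x * y) = 0 := by
    intro a b hab x y hx hxa hy hyb
    obtain ⟨v, hv, hvx⟩ := exists_mem_apolarIdeal_initialForm hF
      (fun σ hσ => hf σ (Ideal.pow_le_pow_right he hσ)) hdim hx hxa
    have h₁ : f.1 ((v - x) * y) = 0 := by
      rw [hf, mem_apolarIdeal_iff.1 hy]
      have := Ideal.mul_mem_mul hvx (mem_pow_of_isHomogeneous hyb)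
      rwa [← pow_add, show a + 1 + b = e + 1 by omega] at this
    have h₂ := mem_apolarIdeal_iff.1 hv y
    rw [sub_mul, map_sub, mul_comm v, h₂, zero_sub, neg_eq_zero] at h₁
    exact h₁
  refine Submodule.mul_induction_on hσ (fun x hx y hy => ?_) fun x y hx hy => ?_
  · have h₁ := sub_sum_homogeneousComponent_mem x (e + 1)
    have h₂ := mem_maxIdeal_pow_iff_homogeneousComponent.1
      (Ideal.mul_mem_right y _ h₁) e (Nat.lt_succ_self e)
    rw [sub_mul, map_sub, sub_eq_zero] at h₂
    rw [h₂, Finset.sum_mul, map_sum, map_sum]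
    refine Finset.sum_eq_zero fun a ha => ?_
    rw [Finset.mem_range] at ha
    have h₃ := homogeneousComponent_mul_of_isHomogeneous
      (isHomogeneous_homogeneousComponent x a) (e - a) y
    rw [Nat.add_sub_cancel' (by omega)] at h₃
    rw [h₃]
    exact hom a (e - a) (by omega) _ _ (homogeneousComponent_mem_apolarIdeal hF hx a)
      (isHomogeneous_homogeneousComponent x a) (homogeneousComponent_mem_apolarIdeal hF hy _)
      (isHomogeneous_homogeneousComponent y _)
  · rw [map_add, map_add, hx, hy, add_zero]

end Homogeneous

/-! ### First-order comparison of automorphisms and derivations -/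

theorem isHomogeneous_zero_eq_algebraMap {τ : S k n} (hτ : IsHomogeneous τ 0) :
    τ = algebraMap k _ (constantCoeff τ) := by
  classical
  ext a
  rw [MvPowerSeries.algebraMap_apply, coeff_C]
  split_ifs with h
  · subst h; simp
  · exact hτ.coeff_eq_zero (by rwa [ne_eq, Finsupp.degree_eq_zero_iff])

theorem isHomogeneous_X (i : Fin n) : IsHomogeneous (X i : S k n) 1 := by
  have : IsHomogeneous (X i : S k n) (Finsupp.single i 1).degree := isHomogeneous_monomial _ 1
  rwa [Finsupp.degree_single] at this

theorem exists_eq_sum_X_mul_of_isHomogeneous {M : ℕ} {τ : S k n} (hτ : IsHomogeneous τ (M + 1)) :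
    ∃ ρ : Fin n → S k n, τ = ∑ i, X i * ρ i ∧ ∀ i, IsHomogeneous (ρ i) M := by
  obtain ⟨ρ, hρ, -⟩ := exists_eq_sum_X_mul_of_mem (mem_pow_of_isHomogeneous hτ)
  refine ⟨fun i => homogeneousComponent M (ρ i), ?_,
    fun i => isHomogeneous_homogeneousComponent _ _⟩
  conv_lhs => rw [← homogeneousComponent_eq_of_isHomogeneous hτ, hρ, map_sum]
  refine Finset.sum_congr rfl fun i _ => ?_
  rw [add_comm, homogeneousComponent_mul_of_isHomogeneous (isHomogeneous_X i)]

/-- The automorphism `αᵢ ↦ αᵢ - D(αᵢ)ₚ₊₁` agrees with `1 - D` to first order, in the part raising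
degrees by `p`. -/
theorem homogeneousComponent_algHom_sub_self_add_derivation {p : ℕ} (hp : 1 ≤ p)
    (D : Derivation k (S k n) (S k n)) (φ : S k n →ₐ[k] S k n)
    (hφ : ∀ i, φ (X i) = X i - homogeneousComponent (p + 1) (D (X i)))
    {M : ℕ} {τ : S k n} (hτ : IsHomogeneous τ M) :
    homogeneousComponent (M + p) (φ τ - τ + D τ) = 0 := by
  have hφX : ∀ i, φ (X i) - X i ∈ maxIdeal k n ^ (p + 1) := fun i => by
    rw [hφ, sub_sub_cancel_left]
    exact (Ideal.neg_mem_iff _).2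
      (mem_pow_of_isHomogeneous (isHomogeneous_homogeneousComponent _ _))
  induction M generalizing τ with
  | zero =>
    rw [isHomogeneous_zero_eq_algebraMap hτ, AlgHom.commutes, sub_self, Derivation.map_algebraMap,
      add_zero, map_zero]
  | succ M ih =>
    obtain ⟨ρ, rfl, hρ⟩ := exists_eq_sum_X_mul_of_isHomogeneous hτ
    rw [map_sum, map_sum, ← Finset.sum_sub_distrib, ← Finset.sum_add_distrib, map_sum]
    refine Finset.sum_eq_zero fun i _ => ?_
    have h₁ : homogeneousComponent (M + 1 + p) (X i * (φ (ρ i) - ρ i + D (ρ i))) = 0 := by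
      rw [show M + 1 + p = 1 + (M + p) by omega,
        homogeneousComponent_mul_of_isHomogeneous (isHomogeneous_X i), ih (hρ i), mul_zero]
    have h₂ : homogeneousComponent (M + 1 + p)
        (ρ i * (D (X i) - homogeneousComponent (p + 1) (D (X i)))) = 0 := by
      rw [show M + 1 + p = M + (p + 1) by omega,
        homogeneousComponent_mul_of_isHomogeneous (hρ i), map_sub,
        homogeneousComponent_homogeneousComponent, if_pos rfl, sub_self, mul_zero]
    -- The second-order term has order at least M + 1 + 2p, which exceeds M + 1 + p because `p ≥ 1`.
    have h₃ : homogeneousComponent (M + 1 + p) ((φ (X i) - X i) * (φ (ρ i) - ρ i)) = 0 := by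
      refine (mem_maxIdeal_pow_iff_homogeneousComponent (D := p + 1 + (M + p))).1 ?_ _ (by omega)
      rw [pow_add]
      exact Ideal.mul_mem_mul (hφX i)
        (algHom_sub_self_mem hφX (mem_pow_of_isHomogeneous (hρ i)))
    have h₄ : φ (X i * ρ i) - X i * ρ i + D (X i * ρ i) =
        X i * (φ (ρ i) - ρ i + D (ρ i)) +
          ρ i * (D (X i) - homogeneousComponent (p + 1) (D (X i))) +
          (φ (X i) - X i) * (φ (ρ i) - ρ i) := by
      rw [map_mul, Derivation.leibniz, smul_eq_mul, smul_eq_mul, hφ]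
      ring
    rw [h₄, map_add, map_add, h₁, h₂, h₃, add_zero, add_zero]

/-! ### Removing one degree by a tangent direction -/

/-- On the finite-dimensional degree-`e` part of S, the restriction of 𝔤⁺F equals its double
annihilator. Its annihilator there is the degree-`e` part of I, which `f` kills. -/
theorem exists_unipotentTangent_apply_eq {f F : P k n} {e : ℕ} {I : Ideal (S k n)}
    (hI : ∀ σ ∈ I, f.1 (homogeneousComponent e σ) = 0)
    (hperp : gradedPart e (perp (tangentSpace F)) = gradedPart e (I.restrictScalars k)) :
    ∃ L ∈ unipotentTangent k n, ∀ τ, IsHomogeneous τ e → F.1 (L τ) = f.1 τ := by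
  let V := LinearMap.range (homogeneousComponent e : S k n →ₗ[k] S k n)
  have : FiniteDimensional k V := finiteDimensional_range_homogeneousComponent e
  let W : Submodule k (Module.Dual k V) := (tangentSpace F).map V.subtype.dualMap
  have hmem : V.subtype.dualMap f.1 ∈ W := by
    rw [← Subspace.dualCoannihilator_dualAnnihilator_eq (W := W), Submodule.mem_dualAnnihilator]
    rintro ⟨_, σ, rfl⟩ hv
    have hh : IsHomogeneous (homogeneousComponent e σ) e := isHomogeneous_homogeneousComponent σ e
    have h₁ : homogeneousComponent e σ ∈ gradedPart e (perp (tangentSpace F)) := by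
      refine ⟨(Submodule.mem_dualCoannihilator _).2 fun w hw => ?_, hh⟩
      exact (Submodule.mem_dualCoannihilator _).1 hv _ (Submodule.mem_map_of_mem hw)
    rw [hperp] at h₁
    have h₂ := hI _ h₁.1
    rwa [homogeneousComponent_eq_of_isHomogeneous hh] at h₂
  obtain ⟨_, ⟨L, hL, rfl⟩, hLf⟩ := hmem
  refine ⟨L, hL, fun τ hτ => ?_⟩
  exact LinearMap.congr_fun hLf ⟨τ, τ, homogeneousComponent_eq_of_isHomogeneous hτ⟩

theorem exists_mem_unipotentOrbit_of_tangent {f F : P k n} {d e : ℕ} (he : e < d)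
    (hF : ∀ σ, F.1 σ = F.1 (homogeneousComponent d σ))
    (hf : ∀ σ ∈ maxIdeal k n ^ (e + 1), f.1 σ = F.1 σ)
    {L : Module.End k (S k n)} (hL : L ∈ unipotentTangent k n)
    (hLf : ∀ τ, IsHomogeneous τ e → F.1 (L τ) = f.1 τ) :
    ∃ h ∈ unipotentOrbit f, ∀ σ ∈ maxIdeal k n ^ e, h.1 σ = F.1 σ := by
  obtain ⟨_, ⟨D, -, rfl⟩, _, ⟨s, -, rfl⟩, rfl⟩ := Submodule.mem_sup.1 hL
  obtain ⟨p, rfl⟩ := Nat.exists_eq_add_of_lt he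
  rw [add_assoc] at *
  -- `q` is d - e, the only degree shift from degree e that F detects. Only this part of D and s
  -- enters the group element.
  generalize hq : p + 1 = q at *
  have hq1 : 1 ≤ q := by omega
  obtain ⟨G, hG, φ, hφ, hGφ⟩ := exists_mem_unipotentGroup hq1
    (fun i => homogeneousComponent (q + 1) (D (X i)))
    (fun i => mem_pow_of_isHomogeneous (isHomogeneous_homogeneousComponent _ _))
    (homogeneousComponent q s) (mem_pow_of_isHomogeneous (isHomogeneous_homogeneousComponent _ _))
  have hφX : ∀ i, φ (X i) - X i ∈ maxIdeal k n ^ (q + 1) := fun i => by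
    rw [hφ, sub_sub_cancel_left]
    exact (Ideal.neg_mem_iff _).2
      (mem_pow_of_isHomogeneous (isHomogeneous_homogeneousComponent _ _))
  have hs : homogeneousComponent q s ∈ maxIdeal k n ^ q :=
    mem_pow_of_isHomogeneous (isHomogeneous_homogeneousComponent _ _)
  have hGe : ∀ τ, G τ - τ = (φ τ - τ) - homogeneousComponent q s * (φ τ - τ) -
      homogeneousComponent q s * τ := fun τ => by rw [hGφ]; ring
  have hGm : ∀ {M : ℕ} {τ : S k n}, τ ∈ maxIdeal k n ^ M → G τ - τ ∈ maxIdeal k n ^ (M + q) := by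
    intro M τ hτ
    have h₁ := algHom_sub_self_mem hφX hτ
    rw [hGe]
    refine Ideal.sub_mem _ (Ideal.sub_mem _ h₁ (Ideal.mul_mem_left _ _ h₁)) ?_
    rw [mul_comm, pow_add]
    exact Ideal.mul_mem_mul hτ hs
  have hGhom : ∀ τ, IsHomogeneous τ e → F.1 (G τ - τ) = - f.1 τ := by
    intro τ hτ
    have h₁ := homogeneousComponent_algHom_sub_self_add_derivation hq1 D φ hφ hτ
    have h₂ : homogeneousComponent (e + q) (homogeneousComponent q s * (φ τ - τ)) = 0 := by
      refine (mem_maxIdeal_pow_iff_homogeneousComponent (D := q + (e + q))).1 ?_ _ (by omega)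
      rw [pow_add]
      exact Ideal.mul_mem_mul hs (algHom_sub_self_mem hφX (mem_pow_of_isHomogeneous hτ))
    have h₃ : homogeneousComponent (e + q) (homogeneousComponent q s * τ) =
        homogeneousComponent (e + q) (s * τ) := by
      rw [mul_comm, mul_comm s, homogeneousComponent_mul_of_isHomogeneous hτ,
        homogeneousComponent_mul_of_isHomogeneous hτ, homogeneousComponent_homogeneousComponent,
        if_pos rfl]
    have h₄ : homogeneousComponent (e + q) (G τ - τ) =
        -homogeneousComponent (e + q) (D τ + s * τ) := by
      rw [hGe, map_sub, map_sub, h₂, h₃, map_add]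
      rw [map_add] at h₁
      linear_combination h₁
    rw [← hLf τ hτ, hF, h₄, map_neg, ← hF]
    rfl
  -- G moves 𝔪^e within 𝔪^d, so f(Gσ) = f(σ) + F(Gσ - σ). In degree e the two terms cancel; on
  -- 𝔪^(e+1) the second vanishes, since Gσ - σ ∈ 𝔪^(d+1), and the first is F(σ).
  have hGf : ∀ σ ∈ maxIdeal k n ^ e, f.1 (G σ) = F.1 σ := by
    intro σ hσ
    have h₁ : f.1 (G σ - σ) = F.1 (G σ - σ) :=
      hf _ (Ideal.pow_le_pow_right (by omega) (hGm hσ))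
    have hh : IsHomogeneous (homogeneousComponent e σ) e := isHomogeneous_homogeneousComponent σ e
    have hσ' := sub_homogeneousComponent_mem hσ
    have h₂ := hGhom _ hh
    have h₃ := vanishing_of_homogeneous hF (by omega) (hGm hσ')
    have h₄ := hf _ hσ'
    have h₅ : F.1 (homogeneousComponent e σ) = 0 := by
      rw [hF, homogeneousComponent_homogeneousComponent, if_neg (by omega), map_zero]
    simp only [map_sub] at h₁ h₂ h₃ h₄
    linear_combination h₁ + h₂ + h₃ + h₄ - h₅
  obtain ⟨N, hN⟩ := f.2
  have hP : f.1 ∘ₗ (G : S k n →ₗ[k] S k n) ∈ P k n := by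
    refine ⟨N, fun σ hσ => hN _ ?_⟩
    have := Ideal.add_mem _ (Ideal.pow_le_pow_right (Nat.le_add_right N q) (hGm hσ)) hσ
    rwa [sub_add_cancel] at this
  exact ⟨⟨_, hP⟩, ⟨G, hG, rfl⟩, hGf⟩

/-! ### Descent from degree d to degree t -/

theorem exists_mem_unipotentOrbit_agreeing {f F : P k n} {d t : ℕ}
    (hF : ∀ σ, F.1 σ = F.1 (homogeneousComponent d σ))
    (hf : ∀ σ ∈ maxIdeal k n ^ d, f.1 σ = F.1 σ)
    (hdim : Module.finrank k (Apolar f) = Module.finrank k (Apolar F))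
    (hsq : ∀ i : ℕ, t ≤ i → i < d → gradedPart i (perp (tangentSpace F)) =
      gradedPart i ((apolarIdeal F ^ 2).restrictScalars k)) (htd : t ≤ d) :
    ∃ h ∈ unipotentOrbit f, ∀ σ ∈ maxIdeal k n ^ t, h.1 σ = F.1 σ := by
  induction htd using Nat.decreasingInduction with
  | self => exact ⟨f, self_mem_unipotentOrbit f, hf⟩
  | of_succ e he ih =>
    obtain ⟨h, hh, hhF⟩ := ih fun i hi => hsq i (by omega)
    obtain ⟨ψ⟩ := nonempty_apolar_algEquiv hh
    have hdim' : Module.finrank k (Apolar h) = Module.finrank k (Apolar F) := by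
      rw [← hdim, ψ.toLinearEquiv.finrank_eq]
    obtain ⟨L, hL, hLh⟩ := exists_unipotentTangent_apply_eq
      (fun σ hσ => apply_homogeneousComponent_eq_zero_of_mem_sq hF he hhF hdim' hσ)
      (hsq e le_rfl he)
    obtain ⟨g, hg, hgF⟩ := exists_mem_unipotentOrbit_of_tangent he hF hhF hL hLh
    exact ⟨g, mem_unipotentOrbit_trans hh hg, hgF⟩

theorem apply_homogPart (f : P k n) (d : ℕ) (σ : S k n) :
    (homogPart d f).1 σ = (homogPart d f).1 (homogeneousComponent d σ) := by
  rw [← P_apply_homogeneousComponent, ← P_apply_homogeneousComponent,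
    homogeneousComponent_homogeneousComponent, if_pos rfl]

theorem apply_eq_apply_homogPart_degree {f : P k n} {d : ℕ} (hd : degree f = d) {σ : S k n}
    (hσ : σ ∈ maxIdeal k n ^ d) : f.1 σ = (homogPart d f).1 σ := by
  have hlt : degree f < (d + 1 : ℕ) := by
    rw [hd]
    exact WithBot.coe_lt_coe.2 (Nat.lt_succ_self d)
  have := degree_lt_iff_vanishing.1 hlt _ (sub_homogeneousComponent_mem hσ)
  rwa [map_sub, sub_eq_zero, P_apply_homogeneousComponent] at this

end Macaulay

theorem mainTheorem12 (k : Type*) [Field k] [IsAlgClosed k] (n : ℕ)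
    (f F : Macaulay.P k n) (d : ℕ) (hd : Macaulay.degree f = d)
    (hF : F = Macaulay.homogPart d f)
    (hchar : ringChar k = 0 ∨ d < ringChar k)
    (I : Ideal (Macaulay.S k n)) (hI : I = Macaulay.apolarIdeal F)
    (t : ℕ)
    (hdim : Module.finrank k (Macaulay.Apolar f) = Module.finrank k (Macaulay.Apolar F))
    (hsq : ∀ i : ℕ, t ≤ i → i < d →
      Macaulay.gradedPart i (Macaulay.perp (Macaulay.tangentSpace F)) =
        Macaulay.gradedPart i ((I ^ 2).restrictScalars k)) :
    ∃ g : Macaulay.P k n, Macaulay.degree g < t ∧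
      F + g ∈ Macaulay.unipotentOrbit f ∧
      Nonempty (Macaulay.Apolar f ≃ₐ[k] Macaulay.Apolar (F + g)) := by
  have hFd : ∀ σ, F.1 σ = F.1 (MvPowerSeries.homogeneousComponent d σ) := by
    rw [hF]
    exact Macaulay.apply_homogPart f d
  have hfF : ∀ σ ∈ Macaulay.maxIdeal k n ^ d, f.1 σ = F.1 σ := by
    rw [hF]
    exact fun σ hσ => Macaulay.apply_eq_apply_homogPart_degree hd hσ
  obtain ⟨h, hh, hhF⟩ : ∃ h ∈ Macaulay.unipotentOrbit f,
      ∀ σ ∈ Macaulay.maxIdeal k n ^ t, h.1 σ = F.1 σ := by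
    -- For `t ≥ d` there is nothing to remove, and `f` itself serves.
    rcases le_total t d with htd | htd
    · subst hI
      exact Macaulay.exists_mem_unipotentOrbit_agreeing hFd hfF hdim hsq htd
    · exact ⟨f, Macaulay.self_mem_unipotentOrbit f,
        fun σ hσ => hfF σ (Ideal.pow_le_pow_right htd hσ)⟩
  have hadd : F + (h - F) = h := add_sub_cancel F h
  refine ⟨h - F, Macaulay.degree_lt_iff_vanishing.2 fun σ hσ => ?_, ?_, ?_⟩
  · exact sub_eq_zero.2 (hhF σ hσ)
  · rwa [hadd]
  · rw [hadd]
    exact Macaulay.nonempty_apolar_algEquiv hh
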